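/- There is an absolute constant $A>0$ such that the following holds. Let $d\ge 1$, $M\ge 1$, $B=[0,1]^d$, and let $f:B\to\mathbb R$ be a bandlimited function $f(x)=\int_{\mathbb R^d}F(w)K(w\cdot x)\,dw$, where $F:\mathbb R^d\to\mathbb C$ is integrable with support in $[-M,M]^d$ and $K:\mathbb R\to\mathbb C$; put $C_F=\int_{\mathbb R^d}|F(w)|\,dw$. Let $s>1$ and $C_K>0$, and suppose that $K$ is analytic on $[-dM,dM]$ and has an analytic continuation, of modulus at most $C_K$, to the open region bounded by the Bernstein $s$-ellipse scaled to $[-dM,dM]$ (the ellipse with foci $\pm dM$ and semi-axes $dM\frac{s+s^{-1}}2$ and $dM\frac{s-s^{-1}}2$). Suppose also that $|K|\le 1$ on the real axis. Then for any Borel measure $\mu$ with $\mu(B)<\infty$ and any $0<\varepsilon<1$ there is a ReLU network $\tilde f$ with $d$ inputs (connections between non-neighbouring layers being allowed, and the output being an affine function of the inputs and the hidden units) such that $$\Big(\int_B|\tilde f(x)-f(x)|^2\,d\mu(x)\Big)^{1/2}\le\varepsilon,$$ whose depth $L$ (number of hidden layers) and size $W$ (total number of hidden units) satisfy, with $R=\max\{2,\;C_FC_K\sqrt{\mu(B)}/\varepsilon\}$,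 $$L\le A\,\frac{1}{\log_2^2 s}\,\log_2^2R,\qquad W\le A\,\frac{C_F^2\,\mu(B)}{\varepsilon^2\log_2^2 s}\,\log_2^2R .$$ -/

import Mathlib

open MeasureTheory

/-- A feedforward ReLU network whose signals so far are `n` real numbers (the inputs together with
the values of all units of the earlier hidden layers, so that connections between units in
non-neighbouring layers are allowed). Either there is no further hidden layer and the output is
an affine function of the `n` signals, or there is a further hidden layer of `k` units, where unit
`i` computes `max 0 (∑ j, w i j * v j + θ i)` from the `n` signals `v` and the network goes on with
the `n + k` signals. -/
inductive ReLUNetwork : ℕ → Type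
  | output {n : ℕ} (α : Fin n → ℝ) (β : ℝ) : ReLUNetwork n
  | hidden {n : ℕ} (k : ℕ) (w : Fin k → Fin n → ℝ) (θ : Fin k → ℝ)
      (next : ReLUNetwork (n + k)) : ReLUNetwork n

namespace ReLUNetwork

/-- The function computed by a network. -/
def eval : {n : ℕ} → ReLUNetwork n → (Fin n → ℝ) → ℝ
  | _, output α β, v => (∑ j, α j * v j) + β
  | _, hidden _ w θ next, v =>
      next.eval (Fin.append v fun i => max 0 ((∑ j, w i j * v j) + θ i))

/-- The depth: the number of hidden layers. -/
def depth : {n : ℕ} → ReLUNetwork n → ℕ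
  | _, output _ _ => 0
  | _, hidden _ _ _ next => next.depth + 1

/-- The size: the total number of units in the hidden layers. -/
def size : {n : ℕ} → ReLUNetwork n → ℕ
  | _, output _ _ => 0
  | _, hidden k _ _ next => k + next.size

end ReLUNetwork

/-- The open region bounded by the Bernstein `s`-ellipse scaled to `[-T, T]`: foci `±T`, semi-axes
`T (s + s⁻¹) / 2` and `T (s - s⁻¹) / 2`. -/
def bernsteinEllipse (s T : ℝ) : Set ℂ :=
  {z | z.re ^ 2 / (T * ((s + s⁻¹) / 2)) ^ 2 + z.im ^ 2 / (T * ((s - s⁻¹) / 2)) ^ 2 < 1}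

/-- `K` is analytic on `[-T, T]` and continues analytically from there to the open Bernstein
`s`-ellipse scaled to `[-T, T]`, with modulus at most `C` there. (For `1 < s` and `0 < T` the open
ellipse is a neighbourhood of the segment, so the continuation `G` makes `K` analytic on it.) -/
def HasBoundedBernsteinContinuation (K : ℝ → ℂ) (s T C : ℝ) : Prop :=
  ∃ G : ℂ → ℂ, AnalyticOnNhd ℂ G (bernsteinEllipse s T) ∧
    (∀ t ∈ Set.Icc (-T) T, G (t : ℂ) = K t) ∧
    ∀ z ∈ bernsteinEllipse s T, ‖G z‖ ≤ C

/-- The unit cube `[0, 1]^d`. -/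
def unitCube (d : ℕ) : Set (Fin d → ℝ) := Set.Icc 0 1

/-- `f` is a bandlimited function on `[0, 1]^d` with integrable density `F`, kernel `K` and band
`[-M, M]^d`: on the cube, `f x = ∫ F(w) K(w · x) dw`, and `F` is supported in `[-M, M]^d`. -/
structure IsBandlimited (d : ℕ) (M : ℝ) (F : (Fin d → ℝ) → ℂ) (K : ℝ → ℂ)
    (f : (Fin d → ℝ) → ℝ) : Prop where
  integrable : Integrable F
  support_subset : Function.support F ⊆ Set.Icc (fun _ => -M) (fun _ => M)
  eq_integral : ∀ x ∈ unitCube d, (f x : ℂ) = ∫ w, F w * K (w ⬝ᵥ x)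

/-!
A network with a single hidden layer suffices: the size bound leaves room for it, and the depth bound
is at least `1` whenever a hidden layer is needed.

In the angle `θ`, where `t = -d M cos θ`, the Bernstein ellipse becomes the strip `|Im θ| < log s`, on
which `K` is bounded by `R` while it is bounded by `1` on the real line. The three lines theorem and
Cauchy's estimate show that `K` is Lipschitz in `θ` with constant `8 log R / log s`
(`norm_sub_le_of_bernsteinEllipse`). Hence `[-d M, d M]` splits into `m = O(log R / log s)` pieces on
each of which `K` varies by at most `1`, and the real part of `u K`, `|u| = 1`, is a uniform limit of
averages of bounded piecewise linear functions with `4 m` kinks (`exists_average_shallow`): such a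
function takes the whole increment of a piece in one short step, and the average runs over the
position of that step. The approximation is exact in the mean, so the number of kinks does not
depend on the accuracy.

Consequently `f / C_F` lies in the uniformly closed convex hull of the shallow networks with `4 m`
units bounded by `3` (`inv_smul_re_integral_mem`, by the Hahn–Banach theorem), and an average of
`N = O(C_F² μ(B) / ε²)` of them approximates it in `L²(μ)` (Maurey's argument,
`exists_seq_norm_sum_sub_sq_le`). The size is `4 m N`.

Two cases need no hidden unit: for `C_F √μ(B) ≤ ε` the zero function is good enough, and for `s ≥ 8 R`
a constant is, by the Schwarz lemma (`norm_sub_zero_le_of_bernsteinEllipse`). In the remaining case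
`log R / log s ≥ 1 / 4`, so that depth `1` and the size `4 m N` are within the bounds.
-/

/-! ### Networks with one hidden layer -/

/-- `φ` is computed by a ReLU network with `d` inputs and a single hidden layer of `n` units. -/
def IsShallow {d : ℕ} (n : ℕ) (φ : (Fin d → ℝ) → ℝ) : Prop :=
  ∃ (w : Fin n → Fin d → ℝ) (θ α : Fin n → ℝ) (β : ℝ),
    ∀ x, φ x = (∑ i, α i * max 0 (w i ⬝ᵥ x + θ i)) + β

namespace IsShallow

variable {d : ℕ}

theorem const (c : ℝ) : IsShallow 0 fun _ : Fin d → ℝ => c :=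
  ⟨Fin.elim0, Fin.elim0, Fin.elim0, c, by simp⟩

theorem relu (w : Fin d → ℝ) (b : ℝ) : IsShallow 1 fun x => max 0 (w ⬝ᵥ x - b) :=
  ⟨fun _ => w, fun _ => -b, fun _ => 1, 0, by simp [sub_eq_add_neg]⟩

theorem const_mul {n : ℕ} {φ : (Fin d → ℝ) → ℝ} (h : IsShallow n φ) (c : ℝ) :
    IsShallow n fun x => c * φ x := by
  obtain ⟨w, θ, α, β, h⟩ := h
  refine ⟨w, θ, fun i => c * α i, c * β, fun x => ?_⟩
  simp only [h, mul_add, Finset.mul_sum, mul_assoc]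

theorem add {n k : ℕ} {φ ψ : (Fin d → ℝ) → ℝ} (h : IsShallow n φ) (h' : IsShallow k ψ) :
    IsShallow (n + k) fun x => φ x + ψ x := by
  obtain ⟨w, θ, α, β, h⟩ := h
  obtain ⟨w', θ', α', β', h'⟩ := h'
  refine ⟨Fin.append w w', Fin.append θ θ', Fin.append α α', β + β', fun x => ?_⟩
  simp only [h, h', Fin.sum_univ_add, Fin.append_left, Fin.append_right]
  ring

theorem sum {n : ℕ} {φ : ℕ → (Fin d → ℝ) → ℝ} (N : ℕ) (h : ∀ j < N, IsShallow n (φ j)) :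
    IsShallow (N * n) fun x => ∑ j ∈ Finset.range N, φ j x := by
  induction N with
  | zero => simpa using const 0
  | succ N ih =>
    simp only [Finset.sum_range_succ, Nat.succ_mul]
    exact (ih fun j hj => h j (by omega)).add (h N (by omega))

theorem exists_reluNetwork {n : ℕ} {φ : (Fin d → ℝ) → ℝ} (h : IsShallow n φ) :
    ∃ Φ : ReLUNetwork d, Φ.depth = 1 ∧ Φ.size = n ∧ ∀ x, Φ.eval x = φ x := by
  obtain ⟨w, θ, α, β, h⟩ := h
  refine ⟨.hidden n w θ (.output (Fin.append 0 α) β), rfl, rfl, fun x => ?_⟩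
  simp [ReLUNetwork.eval, h, Fin.sum_univ_add, dotProduct]

end IsShallow

/-! ### Piecewise linear interpolation as an average of coarse functions -/

/-- The continuous function that is `0` before `p`, `1` after `r` and affine in between. -/
noncomputable def ramp (p r t : ℝ) : ℝ := (max 0 (t - p) - max 0 (t - r)) / (r - p)

theorem ramp_of_le {p r t : ℝ} (hpr : p < r) (ht : t ≤ p) : ramp p r t = 0 := by
  rw [ramp, max_eq_left (by linarith), max_eq_left (by linarith)]; simp

theorem ramp_of_ge {p r t : ℝ} (hpr : p < r) (ht : r ≤ t) : ramp p r t = 1 := by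
  rw [ramp, max_eq_right (by linarith), max_eq_right (by linarith)]
  rw [div_eq_one_iff_eq (by linarith)]; ring

theorem ramp_nonneg {p r : ℝ} (hpr : p < r) (t : ℝ) : 0 ≤ ramp p r t :=
  div_nonneg (sub_nonneg.2 (max_le_max le_rfl (by linarith))) (by linarith)

theorem ramp_le_one {p r : ℝ} (hpr : p < r) (t : ℝ) : ramp p r t ≤ 1 := by
  rw [ramp, div_le_one (by linarith), sub_le_iff_le_add]
  rcases le_total 0 (t - r) with h | h
  · rw [max_eq_right h]; exact max_le (by linarith) (by linarith)
  · rw [max_eq_left h]; exact max_le (by linarith) (by linarith)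

theorem IsShallow.ramp {d : ℕ} (w : Fin d → ℝ) (p r : ℝ) :
    IsShallow 2 fun x => ramp p r (w ⬝ᵥ x) := by
  have h := (((IsShallow.relu w p).add ((IsShallow.relu w r).const_mul (-1))).const_mul (r - p)⁻¹)
  convert h using 2 with x
  rw [_root_.ramp]; ring

/-- A sum whose terms are the increments of `y` before the index `i` and vanish after it. -/
theorem add_sum_range_eq_of_increments {a y : ℕ → ℝ} {n i : ℕ} (hi : i < n)
    (h₁ : ∀ j < i, a j = y (j + 1) - y j) (h₂ : ∀ j, i < j → j < n → a j = 0) :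
    y 0 + ∑ j ∈ Finset.range n, a j = y i + a i := by
  obtain ⟨k, rfl⟩ := Nat.exists_eq_add_of_lt hi
  rw [add_right_comm, Finset.sum_range_add, Finset.sum_range_succ,
    Finset.sum_congr rfl fun j hj => h₁ j (Finset.mem_range.1 hj), Finset.sum_range_sub,
    Finset.sum_eq_zero fun j hj => h₂ _ (by omega) (by have := Finset.mem_range.1 hj; omega)]
  ring

theorem exists_nat_le_le_add_one {n : ℕ} (hn : 0 < n) {x : ℝ} (h₀ : 0 ≤ x) (h₁ : x ≤ n) :
    ∃ j < n, (j : ℝ) ≤ x ∧ x ≤ j + 1 := by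
  rcases h₁.lt_or_eq with h | h
  · exact ⟨⌊x⌋₊, (Nat.floor_lt h₀).2 h, Nat.floor_le h₀, (Nat.lt_floor_add_one x).le⟩
  · refine ⟨n - 1, by omega, ?_, ?_⟩ <;> rw [Nat.cast_sub hn, h] <;> simp

theorem sum_range_mul_eq (f : ℕ → ℝ) (m q : ℕ) :
    ∑ j ∈ Finset.range (m * q), f j =
      ∑ i ∈ Finset.range m, ∑ k ∈ Finset.range q, f (i * q + k) := by
  induction m with
  | zero => simp
  | succ m ih => rw [Nat.succ_mul, Finset.sum_range_add, ih, Finset.sum_range_succ]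

/-- A function `g` on `[-T, T]` with `|g| ≤ 1` that is `L`-Lipschitz in the angle `θ`, where
`t = -T cos θ`, is up to `2 / q` the average of `q` bounded functions with `4 m` kinks each, as soon
as `π L ≤ m`, however large `q` is.

The `m q` Chebyshev nodes form `m` blocks of `q` steps. The `k`-th function jumps, in each block,
only on the `k`-th step, by `q` times the increment of `g` there; on the last step of the block it is
brought back to the value of `g` at the end of the block. The corrections cancel in the average,
which is the piecewise linear interpolation of `g` at all `m q` nodes. -/
theorem exists_average_shallow {T L : ℝ} (hT : 0 < T) {g : ℝ → ℝ}
    (hg : ∀ t ∈ Set.Icc (-T) T, |g t| ≤ 1)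
    (hL : ∀ θ θ' : ℝ, |g (-T * Real.cos θ) - g (-T * Real.cos θ')| ≤ L * |θ - θ'|)
    {m : ℕ} (hm : 0 < m) (hLm : Real.pi * L ≤ m) {q : ℕ} (hq : 0 < q) :
    ∃ Q : ℕ → ℝ → ℝ,
      (∀ k, ∀ (d : ℕ) (w : Fin d → ℝ), IsShallow (m * 4) fun x => Q k (w ⬝ᵥ x)) ∧
      (∀ k < q, ∀ t ∈ Set.Icc (-T) T, |Q k t| ≤ 3) ∧
      ∀ t ∈ Set.Icc (-T) T, |(∑ k ∈ Finset.range q, (q : ℝ)⁻¹ * Q k t) - g t| ≤ 2 / q := by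
  have hπ := Real.pi_pos
  have hm' : (0 : ℝ) < m := by exact_mod_cast hm
  have hq' : (0 : ℝ) < q := by exact_mod_cast hq
  have hn : (0 : ℝ) < m * q := by positivity
  have hL0 : 0 ≤ L := by simpa using (abs_nonneg _).trans (hL 1 0)
  let a : ℕ → ℝ := fun J => Real.pi * J / (m * q)
  let τ : ℕ → ℝ := fun J => -T * Real.cos (a J)
  let y : ℕ → ℝ := fun J => g (τ J)
  let ρ : ℕ → ℝ → ℝ := fun J => ramp (τ J) (τ (J + 1))
  let D : ℕ → ℝ := fun i => y ((i + 1) * q) - y (i * q)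
  let S : ℕ → ℕ → ℝ → ℝ := fun k i t =>
    (q * (y (i * q + k + 1) - y (i * q + k))) * ρ (i * q + k) t +
      (D i - q * (y (i * q + k + 1) - y (i * q + k))) * ρ (i * q + (q - 1)) t
  have ha0 : ∀ J, 0 ≤ a J := fun J => by positivity
  have haπ : ∀ J, J ≤ m * q → a J ≤ Real.pi := by
    intro J hJ
    have : (J : ℝ) ≤ m * q := by exact_mod_cast hJ
    rw [div_le_iff₀ hn]; exact mul_le_mul_of_nonneg_left this hπ.le
  have hτle : ∀ {I J}, I ≤ J → J ≤ m * q → τ I ≤ τ J := by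
    intro I J hIJ hJ
    have : a I ≤ a J := by
      have : (I : ℝ) ≤ J := by exact_mod_cast hIJ
      simp only [a]; gcongr
    have := Real.cos_le_cos_of_nonneg_of_le_pi (ha0 I) (haπ J hJ) this
    simp only [τ]; nlinarith
  have hτlt : ∀ {J}, J < m * q → τ J < τ (J + 1) := by
    intro J hJ
    have : a J < a (J + 1) := by
      simp only [a]; push_cast; gcongr; linarith
    have := Real.cos_lt_cos_of_nonneg_of_le_pi (ha0 J) (haπ _ hJ) this
    simp only [τ]; nlinarith
  have hyb : ∀ J, |y J| ≤ 1 := fun J => hg _ <| by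
    have h1 := Real.neg_one_le_cos (a J)
    have h2 := Real.cos_le_one (a J)
    constructor <;> simp only [τ] <;> nlinarith
  have hylip : ∀ I p : ℕ, |y (I + p) - y I| ≤ p / q := by
    intro I p
    refine (hL _ _).trans ?_
    have e : a (I + p) - a I = Real.pi * p / (m * q) := by simp only [a]; push_cast; ring
    rw [e, abs_of_nonneg (by positivity), div_eq_mul_inv, mul_inv]
    calc L * (Real.pi * p * ((m : ℝ)⁻¹ * (q : ℝ)⁻¹)) = Real.pi * L * ((m : ℝ)⁻¹ * (p / q)) := by ring
      _ ≤ m * ((m : ℝ)⁻¹ * (p / q)) := by gcongr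
      _ = p / q := by field_simp
  have hidx : ∀ {i k}, i < m → k < q → i * q + k < m * q := by
    intro i k hi hk
    calc i * q + k < i * q + q := by omega
      _ = (i + 1) * q := by ring
      _ ≤ m * q := Nat.mul_le_mul_right _ hi
  -- Every point of the segment lies between two consecutive nodes.
  have hloc : ∀ t ∈ Set.Icc (-T) T, ∃ J < m * q, τ J ≤ t ∧ t ≤ τ (J + 1) ∧ |y J - g t| ≤ 1 / q := by
    intro t ht
    have h1 : -1 ≤ -t / T := by rw [le_div_iff₀ hT]; linarith [ht.2]
    have h2 : -t / T ≤ 1 := by rw [div_le_iff₀ hT]; linarith [ht.1]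
    set θ := Real.arccos (-t / T) with hθ
    have hθ0 : 0 ≤ θ := Real.arccos_nonneg _
    have hθπ : θ ≤ Real.pi := Real.arccos_le_pi _
    have hcos : t = -T * Real.cos θ := by
      rw [hθ, Real.cos_arccos h1 h2]; field_simp
    obtain ⟨J, hJ, hJ1, hJ2⟩ := exists_nat_le_le_add_one (Nat.mul_pos hm hq)
      (x := θ * (m * q) / Real.pi) (by positivity)
      (by rw [div_le_iff₀ hπ]; push_cast; nlinarith)
    rw [le_div_iff₀ hπ] at hJ1
    rw [div_le_iff₀ hπ] at hJ2
    have hJ1' : a J ≤ θ := by rw [div_le_iff₀ hn]; linarith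
    have hJ2' : θ ≤ a (J + 1) := by rw [le_div_iff₀ hn]; push_cast; linarith
    refine ⟨J, hJ, ?_, ?_, ?_⟩
    · have := Real.cos_le_cos_of_nonneg_of_le_pi (ha0 J) hθπ hJ1'
      rw [hcos]; simp only [τ]; nlinarith
    · have := Real.cos_le_cos_of_nonneg_of_le_pi hθ0 (haπ _ hJ) hJ2'
      rw [hcos]; simp only [τ]; nlinarith
    · have h3 : a (J + 1) - a J = Real.pi / (m * q) := by simp only [a]; push_cast; ring
      calc |y J - g t| ≤ L * |a J - θ| := by rw [hcos]; exact hL _ _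
        _ ≤ L * (Real.pi / (m * q)) := by
            gcongr; rw [abs_le]; constructor <;> linarith
        _ = Real.pi * L / (m * q) := by ring
        _ ≤ m / (m * q) := by gcongr
        _ = 1 / q := by field_simp
  refine ⟨fun k t => y 0 + ∑ i ∈ Finset.range m, S k i t, fun k d w => ?_, fun k hk t ht => ?_,
    fun t ht => ?_⟩
  · have := (IsShallow.const (d := d) (y 0)).add (IsShallow.sum (n := 4)
      (φ := fun i x => S k i (w ⬝ᵥ x)) m fun i _ =>
        ((IsShallow.ramp w _ _).const_mul _).add ((IsShallow.ramp w _ _).const_mul _))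
    rwa [zero_add] at this
  · obtain ⟨J, hJ, hJ1, hJ2, -⟩ := hloc t ht
    have hi : J / q < m := Nat.div_lt_of_lt_mul (by rwa [mul_comm] at hJ)
    have hJq1 : J / q * q ≤ J := Nat.div_mul_le_self J q
    have hJq2 : J + 1 ≤ (J / q + 1) * q := Nat.lt_succ_iff.1 (by
      have := Nat.lt_div_mul_add hq (a := J); rw [Nat.add_mul]; omega)
    have key := add_sum_range_eq_of_increments (a := fun i => S k i t)
      (y := fun i => y (i * q)) hi (fun i hij => ?_) (fun i hij him => ?_)
    · have hmem : ∀ k' < q, 0 ≤ ρ (J / q * q + k') t ∧ ρ (J / q * q + k') t ≤ 1 := fun k' hk' =>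
        ⟨ramp_nonneg (hτlt (hidx hi hk')) t, ramp_le_one (hτlt (hidx hi hk')) t⟩
      simp only [zero_mul] at key
      simp only [key, S]
      have b1 := abs_le.1 (hyb (J / q * q))
      have b2 : |D (J / q)| ≤ 1 := by
        have := hylip (J / q * q) q
        rwa [div_self hq'.ne', ← Nat.succ_mul] at this
      have b3 : |q * (y (J / q * q + k + 1) - y (J / q * q + k))| ≤ 1 := by
        have := hylip (J / q * q + k) 1
        rw [abs_mul, abs_of_pos hq']
        calc (q : ℝ) * _ ≤ q * ((1 : ℕ) / q) := by gcongr
          _ = 1 := by push_cast; field_simp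
      have r1 := hmem k hk
      have r2 := hmem (q - 1) (by omega)
      set E := q * (y (J / q * q + k + 1) - y (J / q * q + k))
      set u := ρ (J / q * q + k) t
      set v := ρ (J / q * q + (q - 1)) t
      have e : y (J / q * q) + (E * u + (D (J / q) - E) * v) =
          y (J / q * q) + (E * (u - v) + D (J / q) * v) := by ring
      have c1 : |E * (u - v)| ≤ 1 := by
        rw [abs_mul]
        exact mul_le_one₀ b3 (abs_nonneg _) (by rw [abs_le]; constructor <;> linarith)
      have c2 : |D (J / q) * v| ≤ 1 := by
        rw [abs_mul]
        exact mul_le_one₀ b2 (abs_nonneg _) (by rw [abs_le]; constructor <;> linarith)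
      rw [e]
      have c1 := abs_le.1 c1
      have c2 := abs_le.1 c2
      rw [abs_le]; constructor <;> linarith
    · have h1 : ∀ k' < q, ρ (i * q + k') t = 1 := fun k' hk' => by
        refine ramp_of_ge (hτlt (hidx (hij.trans hi) hk')) (le_trans (hτle ?_ hJ.le) hJ1)
        calc i * q + k' + 1 ≤ i * q + q := by omega
          _ = (i + 1) * q := by ring
          _ ≤ J / q * q := Nat.mul_le_mul_right _ hij
          _ ≤ J := hJq1
      simp only [S, h1 k hk, h1 (q - 1) (by omega), D]; ring
    · have h1 : ∀ k' < q, ρ (i * q + k') t = 0 := fun k' hk' => by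
        refine ramp_of_le (hτlt (hidx him hk')) (le_trans hJ2 (hτle ?_ (hidx him hk').le))
        calc J + 1 ≤ (J / q + 1) * q := hJq2
          _ ≤ i * q := Nat.mul_le_mul_right _ hij
          _ ≤ i * q + k' := by omega
      simp only [S, h1 k hk, h1 (q - 1) (by omega)]; ring
  · have havg : ∑ k ∈ Finset.range q, (q : ℝ)⁻¹ * (y 0 + ∑ i ∈ Finset.range m, S k i t) =
        y 0 + ∑ J ∈ Finset.range (m * q), (y (J + 1) - y J) * ρ J t := by
      rw [sum_range_mul_eq, ← Finset.mul_sum, Finset.sum_add_distrib, Finset.sum_comm]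
      have : ∀ i, ∑ k ∈ Finset.range q, S k i t =
          q * ∑ k ∈ Finset.range q, (y (i * q + k + 1) - y (i * q + k)) * ρ (i * q + k) t := by
        intro i
        have tel : ∑ k ∈ Finset.range q, (y (i * q + k + 1) - y (i * q + k)) = D i := by
          have := Finset.sum_range_sub (fun k => y (i * q + k)) q
          simp only [add_zero, ← add_assoc] at this
          rw [this, ← Nat.succ_mul]
        simp only [S]
        rw [Finset.sum_add_distrib, ← Finset.sum_mul, Finset.sum_sub_distrib, ← Finset.mul_sum, tel]
        simp [mul_assoc, Finset.mul_sum]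
      simp only [this, ← Finset.mul_sum]
      simp; field_simp
    obtain ⟨J, hJ, hJ1, hJ2, hJ3⟩ := hloc t ht
    have key := add_sum_range_eq_of_increments (a := fun I => (y (I + 1) - y I) * ρ I t)
      (y := y) hJ (fun I hI => ?_) (fun I hI hI' => ?_)
    · have r0 := ramp_nonneg (hτlt hJ) t
      have r1 := ramp_le_one (hτlt hJ) t
      have h1 : |(y (J + 1) - y J) * ρ J t| ≤ 1 / q := by
        rw [abs_mul]
        refine (mul_le_of_le_one_right (abs_nonneg _) (abs_le.2 ⟨by linarith, r1⟩)).trans ?_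
        simpa using hylip J 1
      rw [havg, key, add_sub_right_comm]
      have e : (2 : ℝ) / q = 1 / q + 1 / q := by ring
      rw [e]
      exact (abs_add_le _ _).trans (add_le_add hJ3 h1)
    · have : ρ I t = 1 := ramp_of_ge (hτlt (hI.trans hJ)) ((hτle hI hJ.le).trans hJ1)
      simp only [this, mul_one]
    · have : ρ I t = 0 := ramp_of_le (hτlt hI') (hJ2.trans (hτle hI hI'.le))
      simp only [this, mul_zero]

/-! ### Analytic continuation bounds the oscillation -/

theorem mul_cos_mem_bernsteinEllipse {s T : ℝ} (hs : 1 < s) (hT : 0 < T) {z : ℂ}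
    (hz : |z.im| < Real.log s) : -T * Complex.cos z ∈ bernsteinEllipse s T := by
  have hs0 : 0 < s := by linarith
  have hlog : 0 < Real.log s := Real.log_pos hs
  have hre : (-T * Complex.cos z : ℂ).re = -T * (Real.cos z.re * Real.cosh z.im) := by
    rw [Complex.cos_eq]
    simp [Complex.cos_ofReal_re, Complex.cosh_ofReal_re, Complex.sin_ofReal_re,
      Complex.sinh_ofReal_re]
  have him : (-T * Complex.cos z : ℂ).im = T * (Real.sin z.re * Real.sinh z.im) := by
    rw [Complex.cos_eq]
    simp [Complex.cos_ofReal_re, Complex.cosh_ofReal_re, Complex.sin_ofReal_re,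
      Complex.sinh_ofReal_re]
  have hc : Real.cosh z.im < Real.cosh (Real.log s) := by
    rw [Real.cosh_lt_cosh, abs_of_pos hlog]; exact hz
  have hsh : |Real.sinh z.im| < Real.sinh (Real.log s) := by
    rw [Real.abs_sinh]; exact Real.sinh_lt_sinh.2 hz
  have ha : 0 < Real.cosh (Real.log s) := Real.cosh_pos _
  have hb : 0 < Real.sinh (Real.log s) := Real.sinh_pos_iff.2 hlog
  have hc1 : Real.cosh z.im ^ 2 / Real.cosh (Real.log s) ^ 2 < 1 := by
    rw [div_lt_one (by positivity)]; exact pow_lt_pow_left₀ hc (Real.cosh_pos _).le two_ne_zero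
  have hs1 : Real.sinh z.im ^ 2 / Real.sinh (Real.log s) ^ 2 < 1 := by
    rw [div_lt_one (by positivity), sq_lt_sq, abs_of_pos hb]; exact hsh
  rw [bernsteinEllipse, Set.mem_ofPred_eq, hre, him, ← Real.cosh_log hs0, ← Real.sinh_log hs0]
  have e : (-T * (Real.cos z.re * Real.cosh z.im)) ^ 2 / (T * Real.cosh (Real.log s)) ^ 2 +
      (T * (Real.sin z.re * Real.sinh z.im)) ^ 2 / (T * Real.sinh (Real.log s)) ^ 2 =
      Real.cos z.re ^ 2 * (Real.cosh z.im ^ 2 / Real.cosh (Real.log s) ^ 2) +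
        Real.sin z.re ^ 2 * (Real.sinh z.im ^ 2 / Real.sinh (Real.log s) ^ 2) := by
    field_simp
  rw [e]
  have hcs := Real.cos_sq_add_sin_sq z.re
  rcases (sq_nonneg (Real.cos z.re)).lt_or_eq with h | h
  · nlinarith [sq_nonneg (Real.sin z.re)]
  · rw [← h] at hcs ⊢; nlinarith

theorem ofReal_mem_bernsteinEllipse {s T t : ℝ} (hs : 1 < s) (hT : 0 < T)
    (ht : t ∈ Set.Icc (-T) T) : (t : ℂ) ∈ bernsteinEllipse s T := by
  have h1 : -1 ≤ -t / T := by rw [le_div_iff₀ hT]; linarith [ht.2]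
  have h2 : -t / T ≤ 1 := by rw [div_le_iff₀ hT]; linarith [ht.1]
  have := mul_cos_mem_bernsteinEllipse (z := Real.arccos (-t / T)) hs hT
    (by simpa using Real.log_pos hs)
  rw [← Complex.ofReal_cos, Real.cos_arccos h1 h2] at this
  convert this using 1
  push_cast
  have : (T : ℂ) ≠ 0 := by exact_mod_cast hT.ne'
  field_simp

/-- A function analytic in the Bernstein ellipse, bounded by `1` on the segment and by `R` in the
ellipse, is Lipschitz in the angle with constant `8 log R / log s`.

In the angle the ellipse is the strip `|Im z| < log s`. By the three lines theorem the function is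
bounded by `2` in the strip of half-width `log s / (4 log R)`, and Cauchy's estimate applies. -/
theorem norm_sub_le_of_bernsteinEllipse {s T R : ℝ} (hs : 1 < s) (hT : 0 < T) (hR : 2 ≤ R)
    {G : ℂ → ℂ} (hG : AnalyticOnNhd ℂ G (bernsteinEllipse s T))
    (hGR : ∀ z ∈ bernsteinEllipse s T, ‖G z‖ ≤ R)
    (hG1 : ∀ t ∈ Set.Icc (-T) T, ‖G (t : ℝ)‖ ≤ 1) (θ θ' : ℝ) :
    ‖G (-T * Real.cos θ : ℝ) - G (-T * Real.cos θ' : ℝ)‖ ≤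
      8 * Real.log R / Real.log s * |θ - θ'| := by
  have hlog : 0 < Real.log s := Real.log_pos hs
  have hR0 : 0 < R := by linarith
  have hlogR : 1 / 2 < Real.log R := by
    have := Real.log_le_log two_pos hR
    have := Real.log_two_gt_d9
    linarith
  set H : ℂ → ℂ := fun z => G (-T * Complex.cos z) with hH
  set b : ℝ := Real.log s / 2 with hb
  have hb0 : 0 < b := by positivity
  have hHan : ∀ z : ℂ, |z.im| < Real.log s → DifferentiableAt ℂ H z := fun z hz =>
    ((hG _ (mul_cos_mem_bernsteinEllipse hs hT hz)).differentiableAt).comp z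
      (Complex.differentiable_cos.differentiableAt.const_mul _)
  have hHR : ∀ z : ℂ, |z.im| < Real.log s → ‖H z‖ ≤ R := fun z hz =>
    hGR _ (mul_cos_mem_bernsteinEllipse hs hT hz)
  have hHreal : ∀ x : ℝ, H x = G (-T * Real.cos x : ℝ) := fun x => by simp [hH]
  have hH1 : ∀ x : ℝ, ‖H x‖ ≤ 1 := fun x => by
    rw [hHreal]
    have h1 := Real.neg_one_le_cos x
    have h2 := Real.cos_le_one x
    exact hG1 _ ⟨by nlinarith, by nlinarith⟩
  have three : ∀ z : ℂ, |z.im| ≤ b → ‖H z‖ ≤ R ^ (|z.im| / b) := by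
    -- The variable `v` runs through the strip `0 ≤ Re v ≤ b` and `σ = ±1` selects the side.
    have side : ∀ (σ : ℝ), |σ| = 1 → ∀ v : ℂ, 0 ≤ v.re → v.re ≤ b →
        ‖H (σ * Complex.I * v)‖ ≤ R ^ (v.re / b) := by
      intro σ hσ v hv0 hvb
      have him : ∀ v : ℂ, |(σ * Complex.I * v).im| = |v.re| := fun v => by simp [abs_mul, hσ]
      have hd : ∀ v : ℂ, 0 ≤ v.re → v.re ≤ b → |(σ * Complex.I * v).im| < Real.log s := by
        intro v h0 h1
        rw [him, abs_of_nonneg h0]; linarith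
      have key := Complex.HadamardThreeLines.norm_le_interp_of_mem_verticalClosedStrip'
        (f := fun v => H (σ * Complex.I * v)) (z := v) (a := 1) (b := R) hb0 ⟨hv0, hvb⟩ ?_ ?_ ?_ ?_
      · simpa using key
      · apply DifferentiableOn.diffContOnCl
        intro v hv
        have hcl : v ∈ Complex.HadamardThreeLines.verticalClosedStrip 0 b := by
          refine closure_minimal ?_ (isClosed_Icc.preimage Complex.continuous_re) hv
          exact fun w hw => ⟨hw.1.le, hw.2.le⟩
        exact ((hHan _ (hd v hcl.1 hcl.2)).comp v
          (differentiableAt_id.const_mul _)).differentiableWithinAt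
      · refine ⟨R, ?_⟩
        rintro _ ⟨v, hv, rfl⟩
        exact hHR _ (hd v hv.1 hv.2)
      · intro v hv
        have hv : v.re = 0 := hv
        have : σ * Complex.I * v = ((-σ * v.im : ℝ) : ℂ) := by
          apply Complex.ext <;> simp [hv]
        simp only [this]
        exact hH1 _
      · intro v hv
        have hv : v.re = b := hv
        exact hHR _ (hd v (by linarith) (by linarith))
    intro z hz
    rcases le_total 0 z.im with h | h
    · rw [abs_of_nonneg h] at hz ⊢
      have e : ((1 : ℝ) : ℂ) * Complex.I * (-Complex.I * z) = z := by
        rw [Complex.ofReal_one]; linear_combination (-z) * Complex.I_sq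
      simpa only [e, show (-Complex.I * z).re = z.im by simp] using
        side 1 (by simp) (-Complex.I * z) (by simpa using h) (by simpa using hz)
    · rw [abs_of_nonpos h] at hz ⊢
      have e : ((-1 : ℝ) : ℂ) * Complex.I * (Complex.I * z) = z := by
        push_cast; linear_combination (-z) * Complex.I_sq
      simpa only [e, show (Complex.I * z).re = -z.im by simp] using
        side (-1) (by simp) (Complex.I * z) (by simpa using h) (by simpa using hz)
  set r : ℝ := b / (2 * Real.log R) with hr
  have hr0 : 0 < r := by positivity
  have hrb : r ≤ b := div_le_self hb0.le (by linarith)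
  have hball : ∀ x : ℝ, ∀ z ∈ Metric.closedBall (x : ℂ) r, |z.im| ≤ r := by
    intro x z hz
    have := Complex.abs_im_le_norm (z - x)
    rw [Metric.mem_closedBall, dist_eq_norm] at hz
    simpa using this.trans hz
  have hderiv : ∀ x : ℝ, ‖deriv H x‖ ≤ 2 / r := by
    intro x
    refine Complex.norm_deriv_le_of_forall_mem_sphere_norm_le hr0 ?_ fun z hz => ?_
    · apply DifferentiableOn.diffContOnCl
      intro z hz
      have := hball x z (Metric.closure_ball_subset_closedBall hz)
      exact (hHan z (by linarith)).differentiableWithinAt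
    · have hz := hball x z (Metric.sphere_subset_closedBall hz)
      calc ‖H z‖ ≤ R ^ (|z.im| / b) := three z (hz.trans hrb)
        _ ≤ R ^ (r / b) := by gcongr; linarith
        _ = Real.exp (1 / 2) := by
          rw [Real.rpow_def_of_pos hR0, hr]
          congr 1
          field_simp
        _ ≤ 2 := by
          rw [← Real.le_log_iff_exp_le two_pos]
          linarith [Real.log_two_gt_d9]
  have hd : ∀ x : ℝ, HasDerivAt (fun x : ℝ => H x) (deriv H x) x := fun x =>
    ((hHan x (by simpa using hlog)).hasDerivAt).comp_ofReal
  have := Convex.norm_image_sub_le_of_norm_hasDerivWithin_le (s := Set.univ) (x := θ') (y := θ)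
    (fun x _ => (hd x).hasDerivWithinAt) (fun x _ => hderiv x) convex_univ trivial trivial
  rw [hHreal, hHreal, Real.norm_eq_abs] at this
  convert this using 2
  rw [hr, hb]; field_simp; ring

/-- For large `s` a bounded analytic function in the ellipse is almost constant on the segment, by
the Schwarz lemma on the inscribed disc. -/
theorem norm_sub_zero_le_of_bernsteinEllipse {s T C : ℝ} (hs : 2 ≤ s) (hT : 0 < T) {G : ℂ → ℂ}
    (hG : AnalyticOnNhd ℂ G (bernsteinEllipse s T))
    (hGC : ∀ z ∈ bernsteinEllipse s T, ‖G z‖ ≤ C) {t : ℝ} (ht : t ∈ Set.Icc (-T) T) :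
    ‖G t - G 0‖ ≤ 8 * C / s := by
  have hs0 : 0 < s := by linarith
  have hinv : s⁻¹ < s / 2 := by
    rw [inv_lt_iff_one_lt_mul₀ hs0]; nlinarith
  have hinv0 : 0 < s⁻¹ := by positivity
  have h0 : (0 : ℂ) ∈ bernsteinEllipse s T := by simp [bernsteinEllipse]
  have hC : 0 ≤ C := (norm_nonneg _).trans (hGC 0 h0)
  set ρ : ℝ := T * ((s - s⁻¹) / 2) with hρ
  have hρT : T * (s / 4) < ρ := by rw [hρ]; exact mul_lt_mul_of_pos_left (by linarith) hT
  have hρ0 : 0 < ρ := lt_trans (by positivity) hρT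
  have hsub : Metric.ball (0 : ℂ) ρ ⊆ bernsteinEllipse s T := by
    intro z hz
    rw [Metric.mem_ball, dist_zero_right] at hz
    have hle : ρ ≤ T * ((s + s⁻¹) / 2) := by rw [hρ]; gcongr; linarith
    rw [bernsteinEllipse, Set.mem_ofPred_eq, ← hρ]
    calc _ ≤ z.re ^ 2 / ρ ^ 2 + z.im ^ 2 / ρ ^ 2 := by gcongr
      _ = ‖z‖ ^ 2 / ρ ^ 2 := by rw [← Complex.normSq_eq_norm_sq, Complex.normSq_apply]; ring
      _ < 1 := by rw [div_lt_one (by positivity)]; gcongr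
  by_cases htρ : (t : ℂ) ∈ Metric.ball (0 : ℂ) ρ
  · have := Complex.dist_le_div_mul_dist_of_mapsTo_ball (f := G) (c := 0) (R₁ := ρ) (R₂ := 2 * C)
      (fun z hz => (hG z (hsub hz)).differentiableAt.differentiableWithinAt)
      (fun z hz => by
        rw [Metric.mem_closedBall, dist_eq_norm]
        exact (norm_sub_le _ _).trans (by linarith [hGC z (hsub hz), hGC 0 h0])) htρ
    rw [dist_eq_norm, dist_zero_right, Complex.norm_real, Real.norm_eq_abs] at this
    calc _ ≤ 2 * C / ρ * |t| := this
      _ ≤ 2 * C / (T * (s / 4)) * T := by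
        gcongr; exact abs_le.2 ht
      _ = 8 * C / s := by field_simp; ring
  · rw [Metric.mem_ball, dist_zero_right, Complex.norm_real, Real.norm_eq_abs, not_lt] at htρ
    have h4 : s / 4 < 1 := by
      have := htρ.trans (abs_le.2 ht)
      by_contra! h
      nlinarith
    calc _ ≤ 2 * C := (norm_sub_le _ _).trans (by
          linarith [hGC t (ofReal_mem_bernsteinEllipse (by linarith) hT ht), hGC 0 h0])
      _ ≤ 8 * C / s := by rw [le_div_iff₀ hs0]; nlinarith

/-! ### Sampling from a closed convex hull -/

/-- Every `p` in the convex hull of a set bounded by `b` is approximated by averages of `N` elements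
of that set with error `b / √N` (Maurey). The elements are chosen greedily: if `v` is the
current sum of the errors, some element has an inner product with `v - p` at most that of `p`, since
otherwise an open half-space would separate `p` from the set. -/
theorem exists_seq_norm_sum_sub_sq_le {E : Type*} [NormedAddCommGroup E] [InnerProductSpace ℝ E]
    {S : Set E} {b : ℝ} (hS : ∀ x ∈ S, ‖x‖ ≤ b) {p : E} (hp : p ∈ convexHull ℝ S) (N : ℕ) :
    ∃ x : ℕ → E, (∀ j, x j ∈ S) ∧ ‖∑ j ∈ Finset.range N, (x j - p)‖ ^ 2 ≤ N * b ^ 2 := by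
  have step : ∀ v : E, ∃ y ∈ S, ‖v + (y - p)‖ ^ 2 ≤ ‖v‖ ^ 2 + b ^ 2 := by
    intro v
    obtain ⟨y, hy, hle⟩ : ∃ y ∈ S, inner ℝ (v - p) y ≤ inner ℝ (v - p) p := by
      by_contra! hcon
      have hconv : Convex ℝ {y : E | inner ℝ (v - p) p < inner ℝ (v - p) y} :=
        convex_halfSpace_gt (innerₛₗ ℝ (v - p)).isLinear _
      have : p ∈ {y : E | inner ℝ (v - p) p < inner ℝ (v - p) y} :=
        convexHull_min (fun y hy => hcon y hy) hconv hp
      rw [Set.mem_ofPred_eq] at this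
      exact lt_irrefl _ this
    refine ⟨y, hy, ?_⟩
    have hy2 : ‖y‖ ^ 2 ≤ b ^ 2 := pow_le_pow_left₀ (norm_nonneg _) (hS y hy) 2
    rw [norm_add_sq_real, norm_sub_sq_real, inner_sub_right]
    rw [inner_sub_left, inner_sub_left, real_inner_self_eq_norm_sq, real_inner_comm y p] at hle
    linarith [sq_nonneg ‖p‖]
  induction N with
  | zero =>
    obtain ⟨y, hy, -⟩ := step 0
    exact ⟨fun _ => y, fun _ => hy, by simp⟩
  | succ N ih =>
    obtain ⟨x, hx, hxN⟩ := ih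
    obtain ⟨y, hy, hle⟩ := step (∑ j ∈ Finset.range N, (x j - p))
    refine ⟨fun j => if j < N then x j else y, fun j => ?_, ?_⟩
    · dsimp only; split_ifs
      exacts [hx j, hy]
    · have e : ∑ j ∈ Finset.range N, ((if j < N then x j else y) - p) =
          ∑ j ∈ Finset.range N, (x j - p) :=
        Finset.sum_congr rfl fun j hj => by rw [if_pos (Finset.mem_range.1 hj)]
      simp only [Finset.sum_range_succ, e, lt_irrefl, if_false]
      push_cast; linarith

section ContinuousMap

variable {X : Type*} [TopologicalSpace X] [CompactSpace X]

theorem norm_toLp_two_le [MeasurableSpace X] [BorelSpace X] (ν : Measure X) [IsFiniteMeasure ν]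
    (φ : C(X, ℝ)) : ‖ContinuousMap.toLp 2 ν ℝ φ‖ ≤ √(ν.real Set.univ) * ‖φ‖ := by
  have := Lp.norm_le_of_ae_bound (f := ContinuousMap.toLp (E := ℝ) 2 ν ℝ φ) (norm_nonneg φ) (by
    filter_upwards [ContinuousMap.coeFn_toLp (𝕜 := ℝ) (p := 2) ν φ] with x hx
    rw [hx]; exact φ.norm_coe_le_norm x)
  convert this using 2
  rw [Real.sqrt_eq_rpow]
  norm_num
  rfl

/-- Averages of `N` elements of a uniformly bounded set approximate in `L²` every uniform limit of
convex combinations. -/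
theorem exists_average_norm_toLp_sub_le [MeasurableSpace X] [BorelSpace X] (ν : Measure X)
    [IsFiniteMeasure ν] {S : Set C(X, ℝ)} {b : ℝ} (hb : 0 ≤ b) (hS : ∀ φ ∈ S, ‖φ‖ ≤ b) {h : C(X, ℝ)}
    (hh : h ∈ closure (convexHull ℝ S)) {N : ℕ} (hN : 0 < N) {δ : ℝ} (hδ : 0 < δ) :
    ∃ φ : ℕ → C(X, ℝ), (∀ j, φ j ∈ S) ∧
      ‖ContinuousMap.toLp 2 ν ℝ ((N : ℝ)⁻¹ • ∑ j ∈ Finset.range N, φ j - h)‖ ≤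
        √(ν.real Set.univ) * (b / √N + δ) := by
  set ι := ContinuousMap.toLp (E := ℝ) 2 ν ℝ with hι
  set V := √(ν.real Set.univ) with hV
  have hV0 : 0 ≤ V := Real.sqrt_nonneg _
  have hN' : (0 : ℝ) < N := by exact_mod_cast hN
  obtain ⟨p, hp, hpd⟩ := Metric.mem_closure_iff.1 hh δ hδ
  have hιp : ι p ∈ convexHull ℝ (ι '' S) := by
    have := ι.toLinearMap.image_convexHull S
    exact this ▸ Set.mem_image_of_mem _ hp
  obtain ⟨x, hx, hxN⟩ := exists_seq_norm_sum_sub_sq_le (b := V * b) (by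
    rintro _ ⟨φ, hφ, rfl⟩
    exact (norm_toLp_two_le ν φ).trans (by gcongr; exact hS φ hφ)) hιp N
  choose φ hφ hφx using hx
  refine ⟨φ, hφ, ?_⟩
  have h1 : ‖∑ j ∈ Finset.range N, (x j - ι p)‖ ≤ √N * (V * b) := by
    refine abs_le_of_sq_le_sq' ?_ (by positivity) |>.2
    rw [mul_pow, Real.sq_sqrt hN'.le]; exact hxN
  have h2 : ι ((N : ℝ)⁻¹ • ∑ j ∈ Finset.range N, φ j - h) =
      (N : ℝ)⁻¹ • ∑ j ∈ Finset.range N, (x j - ι p) + ι (p - h) := by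
    rw [Finset.sum_sub_distrib, smul_sub, Finset.sum_const, Finset.card_range, map_sub, map_sub,
      map_smul, map_sum, ← Nat.cast_smul_eq_nsmul ℝ, smul_smul, inv_mul_cancel₀ hN'.ne', one_smul]
    simp only [hφx]
    abel
  rw [h2]
  calc _ ≤ _ := norm_add_le _ _
    _ ≤ (N : ℝ)⁻¹ * (√N * (V * b)) + V * δ := by
      rw [norm_smul, norm_inv, Real.norm_natCast]
      gcongr
      refine (norm_toLp_two_le ν _).trans ?_
      gcongr
      rw [← dist_eq_norm, dist_comm]; exact hpd.le
    _ = V * (b / √N + δ) := by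
      have : (N : ℝ)⁻¹ * √N = 1 / √N := by
        have := Real.mul_self_sqrt hN'.le
        field_simp
        linarith
      rw [← mul_assoc, this]; ring

/-- An integral of ridge functions with complex density `F` of mass `C`, divided by `C`, lies in
every closed convex set that contains the real parts of the ridge functions times any unit phase. -/
theorem inv_smul_re_integral_mem {E : Type*} [NormedAddCommGroup E] [MeasurableSpace E] [BorelSpace E]
    [SecondCountableTopology E] {μ : Measure E} {F : E → ℂ} (hF : Integrable F μ)
    {κ : E → C(X, ℂ)} (hF' : Integrable (fun w => F w • κ w) μ) {S : Set C(X, ℝ)}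
    (hSc : IsClosed S) (hSv : Convex ℝ S)
    (hS : ∀ w, F w ≠ 0 → ∀ u : ℂ, ‖u‖ = 1 →
      Complex.reCLM.compLeftContinuous ℝ X (u • κ w) ∈ S)
    (hC : 0 < ∫ w, ‖F w‖ ∂μ) :
    (∫ w, ‖F w‖ ∂μ)⁻¹ • Complex.reCLM.compLeftContinuous ℝ X (∫ w, F w • κ w ∂μ) ∈ S := by
  by_contra hcon
  obtain ⟨ℓ, c, hlt, hgt⟩ := geometric_hahn_banach_closed_point hSv hSc hcon
  have hint : ℓ (Complex.reCLM.compLeftContinuous ℝ X (∫ w, F w • κ w ∂μ)) ≤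
      (∫ w, ‖F w‖ ∂μ) * c := by
    have := (ℓ.comp (Complex.reCLM.compLeftContinuous ℝ X)).integral_comp_comm hF'
    simp only [ContinuousLinearMap.comp_apply] at this
    rw [← this, ← integral_mul_const]
    refine integral_mono ((ℓ.comp (Complex.reCLM.compLeftContinuous ℝ X)).integrable_comp hF')
      (hF.norm.mul_const c) fun w => ?_
    by_cases hw : F w = 0
    · simp [hw]
    · have hn : ‖F w‖ ≠ 0 := norm_ne_zero_iff.2 hw
      have hmem := hlt _ (hS w hw (F w / ‖F w‖) (by simp [hn]))
      have e : F w • κ w = ‖F w‖ • ((F w / ‖F w‖) • κ w) := by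
        rw [← Complex.coe_smul, smul_smul]
        congr 1
        have : (‖F w‖ : ℂ) ≠ 0 := by exact_mod_cast hn
        field_simp
      dsimp only
      rw [e, map_smul, map_smul, smul_eq_mul]
      exact mul_le_mul_of_nonneg_left hmem.le (norm_nonneg _)
  rw [map_smul, smul_eq_mul, ← div_eq_inv_mul, lt_div_iff₀ hC] at hgt
  linarith

end ContinuousMap

/-! ### Bandlimited functions on the unit cube -/

instance instCompactSpaceUnitCube (d : ℕ) : CompactSpace (unitCube d) :=
  isCompact_iff_compactSpace.1 isCompact_Icc

theorem IsShallow.continuous {d n : ℕ} {φ : (Fin d → ℝ) → ℝ} (h : IsShallow n φ) :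
    Continuous φ := by
  obtain ⟨w, θ, α, β, h⟩ := h
  rw [funext h]
  simp only [dotProduct]
  fun_prop

theorem measurableSet_unitCube {d : ℕ} : MeasurableSet (unitCube d) := measurableSet_Icc

theorem dotProduct_mem_Icc {d : ℕ} {M : ℝ} {w x : Fin d → ℝ}
    (hw : w ∈ Set.Icc (fun _ => -M) (fun _ => M)) (hx : x ∈ unitCube d) :
    w ⬝ᵥ x ∈ Set.Icc (-(d * M)) (d * M) := by
  rw [Set.mem_Icc, ← abs_le]
  calc |w ⬝ᵥ x| ≤ ∑ i, |w i * x i| := Finset.abs_sum_le_sum_abs _ _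
    _ ≤ ∑ _i : Fin d, M := by
      refine Finset.sum_le_sum fun i _ => ?_
      have hx0 : 0 ≤ x i := hx.1 i
      have hx1 : x i ≤ 1 := hx.2 i
      have hwi : |w i| ≤ M := abs_le.2 ⟨hw.1 i, hw.2 i⟩
      rw [abs_mul, abs_of_nonneg hx0]
      exact (mul_le_of_le_one_right (abs_nonneg _) hx1).trans hwi
    _ = d * M := by simp

/-- The networks with one hidden layer of `n` units, as functions on the unit cube, bounded by
`b` there. -/
def shallowBall (d n : ℕ) (b : ℝ) : Set C(unitCube d, ℝ) :=
  {φ | (∃ ψ : (Fin d → ℝ) → ℝ, IsShallow n ψ ∧ ∀ x : unitCube d, φ x = ψ x) ∧ ‖φ‖ ≤ b}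

theorem ridge_mem_closure_convexHull {d : ℕ} {M T L : ℝ} (hT : 0 < T) (hTM : T = d * M)
    {g : ℝ → ℝ} (hg : ∀ t ∈ Set.Icc (-T) T, |g t| ≤ 1)
    (hL : ∀ θ θ' : ℝ, |g (-T * Real.cos θ) - g (-T * Real.cos θ')| ≤ L * |θ - θ'|)
    {m : ℕ} (hm : 0 < m) (hLm : Real.pi * L ≤ m) {w : Fin d → ℝ}
    (hw : w ∈ Set.Icc (fun _ => -M) (fun _ => M)) {φ : C(unitCube d, ℝ)}
    (hφ : ∀ x : unitCube d, φ x = g (w ⬝ᵥ x)) :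
    φ ∈ closure (convexHull ℝ (shallowBall d (m * 4) 3)) := by
  rw [Metric.mem_closure_iff]
  intro ε hε
  obtain ⟨q, hq⟩ := exists_nat_gt (2 / ε)
  have hq' : (0 : ℝ) < q := lt_trans (by positivity) hq
  have hq0 : 0 < q := by exact_mod_cast hq'
  obtain ⟨Q, hQs, hQb, hQa⟩ := exists_average_shallow hT hg hL hm hLm hq0
  have hmem : ∀ x : unitCube d, w ⬝ᵥ x ∈ Set.Icc (-T) T := fun x => by
    rw [hTM]; exact dotProduct_mem_Icc hw x.2
  let ψ : ℕ → C(unitCube d, ℝ) := fun k =>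
    ⟨fun x => Q k (w ⬝ᵥ x), (hQs k d w).continuous.comp continuous_subtype_val⟩
  refine ⟨∑ k ∈ Finset.range q, (q : ℝ)⁻¹ • ψ k, ?_, ?_⟩
  · refine (convex_convexHull ℝ _).sum_mem (fun _ _ => by positivity) (by simp [hq'.ne'])
      fun k hk => subset_convexHull ℝ _ ⟨⟨_, hQs k d w, fun _ => rfl⟩, ?_⟩
    rw [ContinuousMap.norm_le _ (by norm_num)]
    exact fun x => hQb k (Finset.mem_range.1 hk) _ (hmem x)
  · rw [dist_comm]
    refine lt_of_le_of_lt ((ContinuousMap.dist_le (by positivity)).2 fun x => ?_)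
      ((div_lt_comm₀ hε hq').1 hq)
    rw [hφ, Real.dist_eq]
    simpa [ContinuousMap.sum_apply, ψ] using hQa _ (hmem x)

theorem eLpNorm_unitCube_le {d : ℕ} {μ : Measure (Fin d → ℝ)} (hμ : μ (unitCube d) ≠ ⊤)
    {h : (Fin d → ℝ) → ℝ} {c : ℝ} (hc : ∀ x ∈ unitCube d, |h x| ≤ c) :
    eLpNorm h 2 (μ.restrict (unitCube d)) ≤ ENNReal.ofReal (c * √(μ.real (unitCube d))) := by
  rcases (unitCube d).eq_empty_or_nonempty with he | ⟨x₀, hx₀⟩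
  · simp [he]
  have hc0 : 0 ≤ c := (abs_nonneg _).trans (hc x₀ hx₀)
  refine (eLpNorm_le_of_ae_bound (C := c)
    ((ae_restrict_iff' measurableSet_unitCube).2 (.of_forall hc))).trans_eq ?_
  rw [Measure.restrict_apply_univ, mul_comm, ENNReal.ofReal_mul hc0, Real.sqrt_eq_rpow,
    ← ENNReal.ofReal_rpow_of_nonneg measureReal_nonneg (by norm_num), measureReal_def,
    ENNReal.ofReal_toReal hμ]
  norm_num

namespace IsBandlimited

variable {d : ℕ} {M : ℝ} {F : (Fin d → ℝ) → ℂ} {K : ℝ → ℂ} {f : (Fin d → ℝ) → ℝ}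

/-- On the cube and the band the ridge functions `x ↦ K (w ⬝ᵥ x)` form a continuous family `κ` in
`C(unitCube d, ℂ)`, so that `f` is the Bochner integral of `F • κ` there. Outside the band `κ` is
built from the extension of `K` by constants. -/
theorem exists_integrable_ridge (h : IsBandlimited d M F K f) (hM : 0 ≤ M)
    (hKc : ContinuousOn K (Set.Icc (-(d * M)) (d * M))) (hK : ∀ t, ‖K t‖ ≤ 1) :
    ∃ κ : (Fin d → ℝ) → C(unitCube d, ℂ), Integrable (fun w => F w • κ w) ∧
      (∀ w, F w ≠ 0 → ∀ x : unitCube d, κ w x = K (w ⬝ᵥ x)) ∧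
      ∀ x : unitCube d, (∫ w, F w • κ w) x = f x := by
  have hT : -(d * M) ≤ d * M := by
    have : 0 ≤ d * M := by positivity
    linarith
  let k : ℝ → ℂ := Set.IccExtend hT ((Set.Icc (-(d * M)) (d * M)).domRestrict K)
  have hk : Continuous k := (continuousOn_iff_continuous_domRestrict.1 hKc).Icc_extend'
  have hkK : ∀ t ∈ Set.Icc (-(d * M)) (d * M), k t = K t := fun t ht =>
    Set.IccExtend_of_mem hT _ ht
  let κ : C(Fin d → ℝ, C(unitCube d, ℂ)) :=
    ContinuousMap.curry ⟨fun p => k (p.1 ⬝ᵥ p.2.1), hk.comp <| continuous_finsetSum _ fun i _ =>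
      ((continuous_apply i).comp continuous_fst).mul
        ((continuous_apply i).comp (continuous_subtype_val.comp continuous_snd))⟩
  have hκ : ∀ w (x : unitCube d), κ w x = k (w ⬝ᵥ x) := fun _ _ => rfl
  have hκ1 : ∀ w, ‖κ w‖ ≤ 1 := fun w => by
    rw [ContinuousMap.norm_le _ zero_le_one]
    exact fun x => hK _
  have hκK : ∀ w, F w ≠ 0 → ∀ x : unitCube d, κ w x = K (w ⬝ᵥ x) := fun w hw x => by
    rw [hκ, hkK _ (dotProduct_mem_Icc (h.support_subset hw) x.2)]
  have hint : Integrable (fun w => F w • κ w) := by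
    refine h.integrable.norm.mono' (h.integrable.aestronglyMeasurable.smul
      κ.continuous.aestronglyMeasurable) (.of_forall fun w => ?_)
    rw [norm_smul]
    exact mul_le_of_le_one_right (norm_nonneg _) (hκ1 w)
  refine ⟨κ, hint, hκK, fun x => ?_⟩
  rw [h.eq_integral x x.2]
  refine ((ContinuousMap.evalCLM ℂ x).integral_comp_comm hint).symm.trans
    (integral_congr_ae (.of_forall fun w => ?_))
  by_cases hw : F w = 0
  · simp [hw]
  · simp [hκK w hw x]

/-- If `K` is close to a constant `c` on the band, then `f` is close to `Re (∫ F * c)`. -/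
theorem abs_re_sub_le (h : IsBandlimited d M F K f) (hM : 0 ≤ M)
    (hKc : ContinuousOn K (Set.Icc (-(d * M)) (d * M))) (hK : ∀ t, ‖K t‖ ≤ 1) {c : ℂ} {η : ℝ}
    (hη : ∀ t ∈ Set.Icc (-(d * M)) (d * M), ‖K t - c‖ ≤ η) {x : Fin d → ℝ} (hx : x ∈ unitCube d) :
    |(∫ w, F w * c).re - f x| ≤ (∫ w, ‖F w‖) * η := by
  obtain ⟨κ, hint, hκK, hκf⟩ := h.exists_integrable_ridge hM hKc hK
  have hint' : Integrable fun w => F w * κ w ⟨x, hx⟩ :=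
    (ContinuousMap.evalCLM ℂ (⟨x, hx⟩ : unitCube d)).integrable_comp hint
  have hf : ∫ w, F w * κ w ⟨x, hx⟩ = f x :=
    ((ContinuousMap.evalCLM ℂ (⟨x, hx⟩ : unitCube d)).integral_comp_comm hint).trans
      (hκf ⟨x, hx⟩)
  have e : (∫ w, F w * c).re - f x = -(∫ w, (F w * κ w ⟨x, hx⟩ - F w * c)).re := by
    rw [integral_sub hint' (h.integrable.mul_const c), hf]
    simp
  rw [e, abs_neg, ← integral_mul_const]
  refine (Complex.abs_re_le_norm _).trans
    (norm_integral_le_of_norm_le (h.integrable.norm.mul_const η) (.of_forall fun w => ?_))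
  by_cases hw : F w = 0
  · simp [hw]
  · rw [← mul_sub, norm_mul, hκK w hw]
    exact mul_le_mul_of_nonneg_left (hη _ (dotProduct_mem_Icc (h.support_subset hw) hx))
      (norm_nonneg _)

/-- Approximation of a bandlimited function by the sum of `N` shallow networks of `4 m` units. -/
theorem exists_shallow_eLpNorm_sub_le (h : IsBandlimited d M F K f) (hd : 1 ≤ d) (hM : 1 ≤ M)
    {s R : ℝ} (hs : 1 < s) (hR : 2 ≤ R) (hG : HasBoundedBernsteinContinuation K s (d * M) R)
    (hK : ∀ t, ‖K t‖ ≤ 1) (hF : 0 < ∫ w, ‖F w‖) {μ : Measure (Fin d → ℝ)}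
    (hμ : μ (unitCube d) ≠ ⊤) {m : ℕ} (hm : Real.pi * (8 * Real.log R / Real.log s) ≤ m) {N : ℕ}
    (hN : 0 < N) {δ : ℝ} (hδ : 0 < δ) :
    ∃ ψ : (Fin d → ℝ) → ℝ, IsShallow (N * (m * 4)) ψ ∧
      eLpNorm (fun x => ψ x - f x) 2 (μ.restrict (unitCube d)) ≤
        ENNReal.ofReal ((∫ w, ‖F w‖) * (√(μ.real (unitCube d)) * (3 / √N + δ))) := by
  obtain ⟨G, hGan, hGK, hGR⟩ := hG
  set T : ℝ := d * M with hTM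
  have hT : 0 < T := by
    have : (1 : ℝ) ≤ d := by exact_mod_cast hd
    positivity
  have hm0 : 0 < m := by
    have h1 := Real.log_pos hs
    have h2 := Real.log_pos (show 1 < R by linarith)
    have : (0 : ℝ) < m := lt_of_lt_of_le (by positivity) hm
    exact_mod_cast this
  have hKc : ContinuousOn K (Set.Icc (-T) T) :=
    (hGan.continuousOn.comp Complex.continuous_ofReal.continuousOn
      fun t ht => ofReal_mem_bernsteinEllipse hs hT ht).congr fun t ht => (hGK t ht).symm
  obtain ⟨κ, hint, hκK, hκf⟩ := h.exists_integrable_ridge (by linarith) hKc hK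
  set C : ℝ := ∫ w, ‖F w‖ with hC
  have hcos : ∀ θ : ℝ, -T * Real.cos θ ∈ Set.Icc (-T) T := fun θ => by
    have h1 := Real.neg_one_le_cos θ
    have h2 := Real.cos_le_one θ
    exact ⟨by nlinarith, by nlinarith⟩
  have hLip := norm_sub_le_of_bernsteinEllipse hs hT hR hGan hGR
    fun t ht => by rw [hGK t ht]; exact hK t
  let fc : C(unitCube d, ℝ) := Complex.reCLM.compLeftContinuous ℝ _ (∫ w, F w • κ w)
  have hfc : ∀ x : unitCube d, fc x = f x := fun x => by
    change ((∫ w, F w • κ w) x).re = f x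
    rw [hκf, Complex.ofReal_re]
  have hmem : C⁻¹ • fc ∈ closure (convexHull ℝ (shallowBall d (m * 4) 3)) := by
    refine inv_smul_re_integral_mem h.integrable hint isClosed_closure
      (convex_convexHull ℝ _).closure (fun w hw u hu => ?_) hF
    refine ridge_mem_closure_convexHull hT hTM (g := fun t => (u * K t).re) (fun t ht => ?_)
      (fun θ θ' => ?_) hm0 hm (h.support_subset hw) fun x => ?_
    · refine (Complex.abs_re_le_norm _).trans ?_
      rw [norm_mul, hu, one_mul]; exact hK t
    · rw [← Complex.sub_re, ← mul_sub]
      refine (Complex.abs_re_le_norm _).trans ?_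
      rw [norm_mul, hu, one_mul, ← hGK _ (hcos θ), ← hGK _ (hcos θ')]
      exact hLip θ θ'
    · change (u * κ w x).re = _
      rw [hκK w hw]
  -- The cube with the restriction of `μ` as a finite measure space.
  set ν : Measure (unitCube d) := μ.comap Subtype.val with hν
  have hme : MeasurableEmbedding (Subtype.val : unitCube d → Fin d → ℝ) :=
    MeasurableEmbedding.subtype_coe measurableSet_unitCube
  have hmap : ν.map Subtype.val = μ.restrict (unitCube d) := map_comap_subtype_coe measurableSet_unitCube μ
  have hνu : ν Set.univ = μ (unitCube d) := by
    rw [hν, comap_subtype_coe_apply measurableSet_unitCube]; simp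
  have : IsFiniteMeasure ν := ⟨by rw [hνu]; exact hμ.lt_top⟩
  obtain ⟨φ, hφ, hφN⟩ := exists_average_norm_toLp_sub_le ν (b := 3) (by norm_num)
    (fun φ hφ => hφ.2) hmem hN hδ
  choose ψ hψ hψφ using fun j => (hφ j).1
  refine ⟨fun x => (C * (N : ℝ)⁻¹) * ∑ j ∈ Finset.range N, ψ j x,
    (IsShallow.sum N fun j _ => hψ j).const_mul _, ?_⟩
  set Δ : C(unitCube d, ℝ) := C • ((N : ℝ)⁻¹ • ∑ j ∈ Finset.range N, φ j - C⁻¹ • fc) with hΔ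
  have hΔx : (fun x => (C * (N : ℝ)⁻¹) * ∑ j ∈ Finset.range N, ψ j x - f x) ∘
      (Subtype.val : unitCube d → Fin d → ℝ) = Δ := by
    funext x
    simp only [hΔ, Function.comp_apply, ContinuousMap.smul_apply, ContinuousMap.sub_apply,
      ContinuousMap.sum_apply, hψφ, hfc, smul_eq_mul]
    field_simp
  rw [← hmap, hme.eLpNorm_map_measure, hΔx,
    ← eLpNorm_congr_ae (ContinuousMap.coeFn_toLp (𝕜 := ℝ) (p := 2) ν Δ)]
  rw [← ENNReal.ofReal_toReal (Lp.eLpNorm_ne_top _), ← Lp.norm_def]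
  refine ENNReal.ofReal_le_ofReal ?_
  rw [hΔ, map_smul, norm_smul, Real.norm_of_nonneg hF.le]
  rw [measureReal_def, hνu] at hφN
  exact mul_le_mul_of_nonneg_left hφN hF.le

end IsBandlimited

/-! ### Approximation with bounded depth and size -/

theorem theorem2 :
    ∃ A : ℝ, 0 < A ∧
      ∀ (d : ℕ) (_ : 1 ≤ d) (M : ℝ) (_ : 1 ≤ M)
        (F : (Fin d → ℝ) → ℂ) (K : ℝ → ℂ) (f : (Fin d → ℝ) → ℝ)
        (_ : IsBandlimited d M F K f)
        (s : ℝ) (_ : 1 < s) (C_K : ℝ) (_ : 0 < C_K)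
        (_ : HasBoundedBernsteinContinuation K s (d * M) C_K)
        (_ : ∀ t : ℝ, ‖K t‖ ≤ 1)
        (C_F : ℝ) (_ : C_F = ∫ w, ‖F w‖)
        (μ : Measure (Fin d → ℝ)) (_ : μ (unitCube d) ≠ ⊤)
        (ε : ℝ) (_ : 0 < ε) (_ : ε < 1),
        ∃ Φ : ReLUNetwork d,
          (Φ.depth : ℝ) ≤
            A * (1 / Real.logb 2 s ^ 2 *
              Real.logb 2 (max 2 (C_F * C_K * √(μ.real (unitCube d)) / ε)) ^ 2) ∧
          (Φ.size : ℝ) ≤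
            A * (C_F ^ 2 * μ.real (unitCube d) / (ε ^ 2 * Real.logb 2 s ^ 2) *
              Real.logb 2 (max 2 (C_F * C_K * √(μ.real (unitCube d)) / ε)) ^ 2) ∧
          eLpNorm (fun x => Φ.eval x - f x) 2 (μ.restrict (unitCube d)) ≤ ENNReal.ofReal ε := by
  -- `20000` exceeds `37 * 120 * 4`, from `N ≤ 37 Y` and `m ≤ 120 n ^ 2` below.
  refine ⟨20000, by norm_num, ?_⟩
  intro d hd M hM F K f h s hs C hC hG hK C_F hCF μ hμ ε hε hε1
  set V : ℝ := √(μ.real (unitCube d)) with hV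
  have hV0 : 0 ≤ V := Real.sqrt_nonneg _
  have hVsq : μ.real (unitCube d) = V ^ 2 := (Real.sq_sqrt measureReal_nonneg).symm
  have hCF0 : 0 ≤ C_F := by rw [hCF]; exact integral_nonneg fun _ => norm_nonneg _
  set R : ℝ := max 2 (C_F * C * V / ε) with hR
  have hR2 : 2 ≤ R := le_max_left _ _
  have hRC : C_F * C * V ≤ R * ε := (div_le_iff₀ hε).1 (le_max_right _ _)
  have hT : (0 : ℝ) < d * M := by
    have : (1 : ℝ) ≤ d := by exact_mod_cast hd
    positivity
  have hKc : ContinuousOn K (Set.Icc (-(d * M)) (d * M)) := by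
    obtain ⟨G, hGan, hGK, -⟩ := hG
    exact (hGan.continuousOn.comp Complex.continuous_ofReal.continuousOn
      fun t ht => ofReal_mem_bernsteinEllipse hs hT ht).congr fun t ht => (hGK t ht).symm
  -- A constant is good enough if `K` is within `η` of a constant and `C_F V η ≤ ε`.
  have hconst : ∀ (c : ℂ) (η : ℝ), (∀ t ∈ Set.Icc (-(d * M)) (d * M), ‖K t - c‖ ≤ η) →
      C_F * η * V ≤ ε → ∃ Φ : ReLUNetwork d, Φ.depth = 0 ∧ Φ.size = 0 ∧
        eLpNorm (fun x => Φ.eval x - f x) 2 (μ.restrict (unitCube d)) ≤ ENNReal.ofReal ε := by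
    intro c η hη hle
    refine ⟨.output 0 (∫ w, F w * c).re, rfl, rfl, ?_⟩
    refine (eLpNorm_unitCube_le hμ (c := C_F * η) fun x hx => ?_).trans
      (ENNReal.ofReal_le_ofReal hle)
    simpa [ReLUNetwork.eval, hCF] using h.abs_re_sub_le (by linarith) hKc hK hη hx
  have hzero : (∃ Φ : ReLUNetwork d, Φ.depth = 0 ∧ Φ.size = 0 ∧
      eLpNorm (fun x => Φ.eval x - f x) 2 (μ.restrict (unitCube d)) ≤ ENNReal.ofReal ε) →
      ∃ Φ : ReLUNetwork d,
        (Φ.depth : ℝ) ≤ 20000 * (1 / Real.logb 2 s ^ 2 * Real.logb 2 R ^ 2) ∧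
        (Φ.size : ℝ) ≤ 20000 * (C_F ^ 2 * μ.real (unitCube d) / (ε ^ 2 * Real.logb 2 s ^ 2) *
          Real.logb 2 R ^ 2) ∧
        eLpNorm (fun x => Φ.eval x - f x) 2 (μ.restrict (unitCube d)) ≤ ENNReal.ofReal ε := by
    rintro ⟨Φ, h1, h2, h3⟩
    refine ⟨Φ, ?_, ?_, h3⟩
    · rw [h1]; push_cast; positivity
    · rw [h2]; push_cast; positivity
  rcases le_or_gt (C_F * V) ε with hsmall | hlarge
  · exact hzero (hconst 0 1 (fun t _ => by simpa using hK t) (by simpa using hsmall))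
  rcases le_or_gt (8 * R) s with hsR | hsR
  · obtain ⟨G, hGan, hGK, hGC⟩ := hG
    refine hzero (hconst (G 0) (8 * C / s) (fun t ht => ?_) ?_)
    · rw [← hGK t ht]
      exact norm_sub_zero_le_of_bernsteinEllipse (by linarith) hT hGan hGC ht
    · have hs0 : 0 < s := by linarith
      rw [show C_F * (8 * C / s) * V = 8 * (C_F * C * V) / s by ring, div_le_iff₀ hs0]
      nlinarith
  have hCR : C ≤ R := by
    by_contra! hlt
    have h1 : C * ε < C * (C_F * V) := mul_lt_mul_of_pos_left hlarge hC
    nlinarith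
  have hGR : HasBoundedBernsteinContinuation K s (d * M) R := by
    obtain ⟨G, hGan, hGK, hGC⟩ := hG
    exact ⟨G, hGan, hGK, fun z hz => (hGC z hz).trans hCR⟩
  have hCV : 0 < C_F * V := hε.trans hlarge
  have hCF1 : 0 < C_F := pos_of_mul_pos_left hCV hV0
  have hV1 : 0 < V := pos_of_mul_pos_right hCV hCF0
  have hlogs : 0 < Real.log s := Real.log_pos hs
  have hlogR : 0 < Real.log R := Real.log_pos (by linarith)
  set n : ℝ := Real.log R / Real.log s with hn
  have hlogb : Real.logb 2 R / Real.logb 2 s = n := by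
    have : Real.log 2 ≠ 0 := (Real.log_pos one_lt_two).ne'
    rw [Real.logb, Real.logb, hn]; field_simp
  -- `s < 8 R ≤ R ^ 4`.
  have hn4 : 1 ≤ 4 * n := by
    have h8 : 8 * R ≤ R ^ 4 := by
      have : (2 : ℝ) ^ 3 ≤ R ^ 3 := by gcongr
      nlinarith
    have := Real.log_le_log (by linarith) (hsR.le.trans h8)
    rw [Real.log_pow] at this
    rw [hn, ← mul_div_assoc, one_le_div hlogs]
    exact_mod_cast this
  set Y : ℝ := (C_F * V / ε) ^ 2 with hY
  have hY1 : 1 ≤ Y := one_le_pow₀ ((one_le_div hε).2 hlarge.le)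
  set m : ℕ := ⌈Real.pi * (8 * Real.log R / Real.log s)⌉₊ with hm
  set N : ℕ := ⌈36 * Y⌉₊ with hN
  have hN0 : 0 < N := Nat.ceil_pos.2 (by linarith)
  obtain ⟨ψ, hψ, hψf⟩ := h.exists_shallow_eLpNorm_sub_le hd hM hs hR2 hGR hK (by rwa [← hCF]) hμ
    (Nat.le_ceil _) hN0 (δ := ε / (2 * (C_F * V))) (by positivity)
  obtain ⟨Φ, hdepth, hsize, heval⟩ := hψ.exists_reluNetwork
  have hm_le : (m : ℝ) ≤ 120 * n ^ 2 := by
    have h1 : (m : ℝ) < Real.pi * (8 * Real.log R / Real.log s) + 1 :=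
      Nat.ceil_lt_add_one (by have := Real.pi_pos; positivity)
    rw [mul_div_assoc, ← hn] at h1
    nlinarith [Real.pi_lt_d2]
  have hN_le : (N : ℝ) ≤ 37 * Y := by
    have := Nat.ceil_lt_add_one (show 0 ≤ 36 * Y by linarith)
    linarith
  refine ⟨Φ, ?_, ?_, ?_⟩
  · rw [hdepth, one_div_mul_eq_div, ← div_pow, hlogb]
    push_cast; nlinarith
  · have e : C_F ^ 2 * μ.real (unitCube d) / (ε ^ 2 * Real.logb 2 s ^ 2) * Real.logb 2 R ^ 2 =
        Y * n ^ 2 := by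
      rw [hVsq, hY, ← hlogb]; field_simp
    rw [hsize, e]
    push_cast
    calc (N : ℝ) * (m * 4) ≤ (37 * Y) * (120 * n ^ 2 * 4) := by gcongr
      _ ≤ 20000 * (Y * n ^ 2) := by nlinarith [mul_nonneg (show 0 ≤ Y by linarith) (sq_nonneg n)]
  · simp only [heval]
    refine hψf.trans (ENNReal.ofReal_le_ofReal ?_)
    rw [← hCF, ← hV]
    have hsq : 6 * (C_F * V / ε) ≤ √N := by
      refine Real.le_sqrt_of_sq_le ?_
      rw [mul_pow, ← hY]
      exact (by norm_num : (6 : ℝ) ^ 2 * Y = 36 * Y).trans_le (Nat.le_ceil _)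
    have h3 : 3 / √N ≤ ε / (2 * (C_F * V)) := by
      calc 3 / √N ≤ 3 / (6 * (C_F * V / ε)) := by gcongr
        _ = ε / (2 * (C_F * V)) := by field_simp; norm_num
    calc C_F * (V * (3 / √N + ε / (2 * (C_F * V))))
        ≤ C_F * (V * (ε / (2 * (C_F * V)) + ε / (2 * (C_F * V)))) := by gcongr
      _ = ε := by field_simp; norm_num
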